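/- **Setting (the calculus RMPC).** Let $\mathcal A$ be a countable set of actions, $\mathcal R=\mathbb R_{>0}$ the set of rates, $\mathcal K$ a countably infinite set of keys, and let $(a,\lambda)\mapsto\overline{\lambda}^{\,a}\in\mathcal R$ (written $\overline\lambda$) assign to every action with rate $\lambda$ a backward rate. Standard processes are $P,Q ::= \underline 0 \mid \langle a,\lambda\rangle.P \mid P+Q \mid P\parallel_L Q$ with $L\subseteq\mathcal A$, and reversible processes are $R,S ::= P \mid \langle a,\lambda\rangle[i].R \mid R+S \mid R\parallel_L S$; $\mathrm{key}(R)$ is the set of keys occurring in $R$. Forward transitions $R\xrightarrow{\langle a,\lambda\rangle[i]}R'$ are the least relations such that: * if $R$ is standard, then $\langle a,\lambda\rangle.R\xrightarrow{\langle a,\lambda\rangle[i]}\langle a,\lambda\rangle[i].R$; * if $R\xrightarrow{\langle b,\mu\rangle[j]}R'$ and $j\ne i$, then $\langle a,\lambda\rangle[i].R\xrightarrow{\langle b,\mu\rangle[j]}\langle a,\lambda\rangle[i].R'$; * if $R\xrightarrow{\langle a,\lambda\rangle[i]}R'$ and $S$ is standard, then $R+S\xrightarrow{\langle a,\lambda\rangle[i]}R'+S$,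 and symmetrically; * if $R\xrightarrow{\langle a,\lambda\rangle[i]}R'$, $a\notin L$ and $i\notin\mathrm{key}(S)$, then $R\parallel_L S\xrightarrow{\langle a,\lambda\rangle[i]}R'\parallel_L S$, and symmetrically; * if $R\xrightarrow{\langle a,\lambda\rangle[i]}R'$, $S\xrightarrow{\langle a,\mu\rangle[i]}S'$ and $a\in L$, then $R\parallel_L S\xrightarrow{\langle a,\lambda\cdot\mu\rangle[i]}R'\parallel_L S'$. Backward transitions are the least relations closed under the same rules, except that the first one is replaced by: if $R$ is standard, then $\langle a,\lambda\rangle[i].R\xrightarrow{\langle a,\overline\lambda\rangle[i]}\langle a,\lambda\rangle.R$ (so the rates of two synchronizing backward transitions are multiplied as well). Let $\mathbb P$ be the set of reachable processes, i.e. those obtained from standard processes by finitely many forward transitions. Let $\equiv_{\mathcal K}$ be the smallest equivalence relation on $\mathbb P$ that identifies a process with the one obtained by replacing all the occurrences of a key by a key not occurring in the process. **Underlying chain.** For $R\in\mathbb P$, between $\equiv_{\mathcal K}$-classes there is a transition $[S]\to[S']$ labeled $\langle a,\lambda\rangle$ whenever some $S_1\in[S]$ has a forward or backward transition labeled $\langle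 a,\lambda\rangle[i]$, for some key $i$, to some $S_1'\in[S']$. The continuous-time Markov chain $\mathcal M[\![R]\!]$ has as states the classes reachable from $[R]$ through such transitions, and for $s\ne s'$ its rate $q_{s,s'}$ is the sum of the rates of all labels $\langle a,\lambda\rangle$ of transitions from $s$ to $s'$; $q_{s,s}=-\sum_{s'\neq s}q_{s,s'}$. That $\mathcal M[\![R]\!]$ is *time reversible* means that it is a well-defined finite chain (finitely many states and transitions) with a unique steady-state distribution $\pi$ (i.e. $\pi(s)>0$ for all $s$, $\sum_s\pi(s)=1$, $\pi\cdot\mathbf Q=0$) and that the chain $X(t)$ with generator $\mathbf Q=(q_{s,s'})$ and initial distribution $\pi$ is such that $(X(t_i))_{1\le i\le n}$ and $(X(t'-t_i))_{1\le i\le n}$ have the same joint distribution for all $n\ge1$ and $0\le t_1<\dots<t_n\le t'$. **Corollary (time reversibility closure).** Let $R_1,R_2\in\mathbb P$ and $L\subseteq\mathcal A$ be such that $R_1\parallel_L R_2\in\mathbb P$. Suppose that 1. every backward rate is equal to the corresponding forward rate, i.e. $\overline\lambda=\lambda$ for all actions and all $\lambda\in\mathcal R$; or 2. parallel composition occurs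 neither in $R_1$ nor in $R_2$ (backward rates being arbitrary). Then $\mathcal M[\![R_1\parallel_L R_2]\!]$ is time reversible. -/

import Mathlib

namespace RMPC

/-- Rates are positive real numbers. -/
abbrev Rate : Type := {x : ℝ // 0 < x}

/-- Terms of the calculus. `pre a r P` is the future prefix `<a,r>.P`, `past a r i R` is the executed
prefix `<a,r>[i].R` with communication key `i`, and `par R L S` is the parallel composition of `R` and
`S` with synchronization set `L`. (Terms in which a future prefix precedes an executed one are excluded
by `Reachable` below.) -/
inductive Proc (Act Key : Type*) where
  | nil : Proc Act Key
  | pre (a : Act) (r : Rate) (P : Proc Act Key) : Proc Act Key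
  | past (a : Act) (r : Rate) (i : Key) (R : Proc Act Key) : Proc Act Key
  | choice (R S : Proc Act Key) : Proc Act Key
  | par (R : Proc Act Key) (L : Set Act) (S : Proc Act Key) : Proc Act Key

namespace Proc

variable {Act Key : Type*}

/-- Standard forward processes: no executed prefix occurs. -/
def Std : Proc Act Key → Prop
  | nil => True
  | pre _ _ P => Std P
  | past _ _ _ _ => False
  | choice R S => Std R ∧ Std S
  | par R _ S => Std R ∧ Std S

/-- The set of keys occurring in a process. -/
def keys : Proc Act Key → Set Key
  | nil => ∅
  | pre _ _ P => keys P
  | past _ _ i R => {i} ∪ keys R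
  | choice R S => keys R ∪ keys S
  | par R _ S => keys R ∪ keys S

/-- Parallel composition does not occur in the process. -/
def NoPar : Proc Act Key → Prop
  | nil => True
  | pre _ _ P => NoPar P
  | past _ _ _ R => NoPar R
  | choice R S => NoPar R ∧ NoPar S
  | par _ _ _ => False

open Classical in
/-- Replace every occurrence of the key `i` by the key `j`. -/
noncomputable def renameKey (i j : Key) : Proc Act Key → Proc Act Key
  | nil => nil
  | pre a r P => pre a r (renameKey i j P)
  | past a r k R => past a r (if k = i then j else k) (renameKey i j R)
  | choice R S => choice (renameKey i j R) (renameKey i j S)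
  | par R L S => par (renameKey i j R) L (renameKey i j S)

end Proc

open Proc

/-- Forward transitions: `Fwd R a r i R'` is the transition from `R` to `R'` labeled `<a,r>[i]`. -/
inductive Fwd {Act Key : Type*} : Proc Act Key → Act → Rate → Key → Proc Act Key → Prop
  | act1 {a : Act} {r : Rate} {i : Key} {R : Proc Act Key} :
      R.Std → Fwd (pre a r R) a r i (past a r i R)
  | act2 {a b : Act} {r m : Rate} {i j : Key} {R R' : Proc Act Key} :
      Fwd R b m j R' → j ≠ i → Fwd (past a r i R) b m j (past a r i R')
  | choL {a : Act} {r : Rate} {i : Key} {R R' S : Proc Act Key} :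
      Fwd R a r i R' → S.Std → Fwd (choice R S) a r i (choice R' S)
  | choR {a : Act} {r : Rate} {i : Key} {R S S' : Proc Act Key} :
      Fwd S a r i S' → R.Std → Fwd (choice R S) a r i (choice R S')
  | parL {a : Act} {r : Rate} {i : Key} {R R' S : Proc Act Key} {L : Set Act} :
      Fwd R a r i R' → a ∉ L → i ∉ S.keys → Fwd (par R L S) a r i (par R' L S)
  | parR {a : Act} {r : Rate} {i : Key} {R S S' : Proc Act Key} {L : Set Act} :
      Fwd S a r i S' → a ∉ L → i ∉ R.keys → Fwd (par R L S) a r i (par R L S')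
  | coo {a : Act} {r m : Rate} {i : Key} {R R' S S' : Proc Act Key} {L : Set Act} :
      Fwd R a r i R' → Fwd S a m i S' → a ∈ L → Fwd (par R L S) a (r * m) i (par R' L S')

/-- Backward transitions. `bar a r` is the rate at which an executed action `<a,r>` is undone; the rate
of the undoing of a synchronization is the product of the backward rates of the two participants. -/
inductive Bwd {Act Key : Type*} (bar : Act → Rate → Rate) :
    Proc Act Key → Act → Rate → Key → Proc Act Key → Prop
  | act1 {a : Act} {r : Rate} {i : Key} {R : Proc Act Key} :
      R.Std → Bwd bar (past a r i R) a (bar a r) i (pre a r R)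
  | act2 {a b : Act} {r m : Rate} {i j : Key} {R R' : Proc Act Key} :
      Bwd bar R b m j R' → j ≠ i → Bwd bar (past a r i R) b m j (past a r i R')
  | choL {a : Act} {r : Rate} {i : Key} {R R' S : Proc Act Key} :
      Bwd bar R a r i R' → S.Std → Bwd bar (choice R S) a r i (choice R' S)
  | choR {a : Act} {r : Rate} {i : Key} {R S S' : Proc Act Key} :
      Bwd bar S a r i S' → R.Std → Bwd bar (choice R S) a r i (choice R S')
  | parL {a : Act} {r : Rate} {i : Key} {R R' S : Proc Act Key} {L : Set Act} :
      Bwd bar R a r i R' → a ∉ L → i ∉ S.keys → Bwd bar (par R L S) a r i (par R' L S)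
  | parR {a : Act} {r : Rate} {i : Key} {R S S' : Proc Act Key} {L : Set Act} :
      Bwd bar S a r i S' → a ∉ L → i ∉ R.keys → Bwd bar (par R L S) a r i (par R L S')
  | coo {a : Act} {r m : Rate} {i : Key} {R R' S S' : Proc Act Key} {L : Set Act} :
      Bwd bar R a r i R' → Bwd bar S a m i S' → a ∈ L →
        Bwd bar (par R L S) a (r * m) i (par R' L S')

section UnderlyingChain

variable {Act Key : Type*}

/-- Reachable processes: those obtained from a standard forward process by finitely many forward
transitions. -/
def Reachable (R : Proc Act Key) : Prop :=
  ∃ P : Proc Act Key, P.Std ∧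
    Relation.ReflTransGen (fun S S' => ∃ (a : Act) (r : Rate) (i : Key), Fwd S a r i S') P R

variable (Act Key) in
/-- The set of reachable processes. -/
abbrev RProc : Type _ := {R : Proc Act Key // Reachable R}

variable (Act Key) in
/-- The smallest equivalence on reachable processes that identifies a process with the one obtained by
replacing a key by a fresh one. In a reachable process the occurrences of a key are exactly the
participants of one synchronization (a single one if the action was performed alone), so all of them
are replaced together. -/
def keyEquiv : Setoid (RProc Act Key) :=
  Relation.EqvGen.setoid fun R S =>
    ∃ i j : Key, j ∉ R.1.keys ∧ S.1 = R.1.renameKey i j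

variable (Act Key) in
/-- Classes of reachable processes up to keys. -/
abbrev KClass : Type _ := Quotient (keyEquiv Act Key)

/-- The class of a reachable process. -/
def RProc.cls (R : RProc Act Key) : KClass Act Key := Quotient.mk _ R

/-- Forward transitions between classes; keys are dropped from labels. -/
def FwdK (s : KClass Act Key) (a : Act) (r : Rate) (s' : KClass Act Key) : Prop :=
  ∃ S S' : RProc Act Key, S.cls = s ∧ S'.cls = s' ∧ ∃ i : Key, Fwd S.1 a r i S'.1

/-- Backward transitions between classes; keys are dropped from labels. -/
def BwdK (bar : Act → Rate → Rate) (s : KClass Act Key) (a : Act) (r : Rate)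
    (s' : KClass Act Key) : Prop :=
  ∃ S S' : RProc Act Key, S.cls = s ∧ S'.cls = s' ∧ ∃ i : Key, Bwd bar S.1 a r i S'.1

/-- Transitions between classes. -/
def TransK (bar : Act → Rate → Rate) (s : KClass Act Key) (a : Act) (r : Rate)
    (s' : KClass Act Key) : Prop :=
  FwdK s a r s' ∨ BwdK bar s a r s'

/-- The states of the chain underlying `R`: the classes reachable from the initial state, the class of
`R`, through (forward and backward) transitions. -/
def ChainState (bar : Act → Rate → Rate) (R : RProc Act Key) : Type _ :=
  {s : KClass Act Key //
    Relation.ReflTransGen (fun u v => ∃ (a : Act) (r : Rate), TransK bar u a r v) R.cls s}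

/-- The rate from `s` to `s'`: the sum of the rates of all transitions from `s` to `s'`. -/
noncomputable def chainRate (bar : Act → Rate → Rate) (R : RProc Act Key)
    (s s' : ChainState bar R) : ℝ :=
  ∑ᶠ l ∈ {l : Act × Rate | TransK bar s.1 l.1 l.2 s'.1}, (l.2 : ℝ)

end UnderlyingChain

section MarkovChain

variable {S : Type*} [Fintype S] [DecidableEq S]

/-- The infinitesimal generator with off-diagonal rates `q` and rows summing up to `0`. -/
def generator (q : S → S → ℝ) : Matrix S S ℝ :=
  Matrix.of fun s s' => if s = s' then - ∑ u ∈ Finset.univ.erase s, q s u else q s s'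

/-- The matrix of the probabilities `Pr {X(u + t) = s' | X(u) = s}` of the time-homogeneous chain with
generator `Q`. -/
noncomputable def transProb (Q : Matrix S S ℝ) (t : ℝ) : Matrix S S ℝ :=
  NormedSpace.exp (t • Q)

/-- A steady-state distribution: a strictly positive probability vector that satisfies the global
balance equations. -/
def IsSteadyState (Q : Matrix S S ℝ) (p : S → ℝ) : Prop :=
  (∀ s, 0 < p s) ∧ ∑ s, p s = 1 ∧ Matrix.vecMul p Q = 0

/-- The joint distribution `Pr {X(t 0) = s 0, …, X(t n) = s n}`, for times `0 ≤ t 0 < … < t n`, of the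
chain with generator `Q` and initial distribution `p` at time `0`. -/
noncomputable def jointProb (Q : Matrix S S ℝ) (p : S → ℝ) {n : ℕ}
    (t : Fin (n + 1) → ℝ) (s : Fin (n + 1) → S) : ℝ :=
  Matrix.vecMul p (transProb Q (t 0)) (s 0) *
    ∏ i : Fin n, transProb Q (t i.succ - t i.castSucc) (s i.castSucc) (s i.succ)

/-- Time reversibility: the chain has exactly one steady-state distribution, and, started from it,
`(X(t i))` and `(X(t' - t i))` have the same joint distribution. As the times `t' - t i` are decreasing
in `i`, the event `X(t' - t i) = s i` for all `i` is listed in reverse order. -/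
def IsTimeReversible (Q : Matrix S S ℝ) : Prop :=
  (∃! p : S → ℝ, IsSteadyState Q p) ∧
  ∀ p : S → ℝ, IsSteadyState Q p →
    ∀ (n : ℕ) (t : Fin (n + 1) → ℝ) (t' : ℝ), StrictMono t → 0 ≤ t 0 → t (Fin.last n) ≤ t' →
      ∀ s : Fin (n + 1) → S,
        jointProb Q p t s = jointProb Q p (fun i => t' - t i.rev) (fun i => s i.rev)

end MarkovChain

open Classical in
/-- The continuous-time Markov chain underlying `R` is a well-defined finite one (finitely many states
and finitely many transitions) and is time reversible. -/
def UnderlyingTimeReversible {Act Key : Type*} (bar : Act → Rate → Rate) (R : RProc Act Key) : Prop :=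
  (∀ s s' : ChainState bar R, {l : Act × Rate | TransK bar s.1 l.1 l.2 s'.1}.Finite) ∧
  ∃ _ : Fintype (ChainState bar R), IsTimeReversible (generator (chainRate bar R))

end RMPC

/-! Give a process the weight w, the product over its executed prefixes of (forward rate)/(backward
rate). Every forward transition at rate r is undone by a backward one at some rate r', and it
multiplies w by r/r'. For a synchronization this persists, because the rates are multiplied in both
directions (`Step.weight_balance`).

Between two classes there is at most one transition, since its label can be read off the key-erased
source and target (`Step.label_unique`). Hence q(s,s') and q(s',s) are exactly such r and r', and w
satisfies detailed balance on the chain. Every transition can be undone, so the chain is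
irreducible. It is finite because transitions preserve the underlying standard process and finitely
many keys suffice to represent all classes over it (`finite_setOf_shape_base_eq`).

For a finite irreducible chain, detailed balance yields time reversibility: normalized w is the only
steady state, and the exponential of the generator inherits the balance. -/

namespace RMPC

open Proc

/-! ### Finite Markov chains: detailed balance implies time reversibility -/

section Reversibility

variable {S : Type*} [Fintype S] [DecidableEq S]

theorem generator_off_diag (q : S → S → ℝ) {s s' : S} (h : s ≠ s') :
    generator q s s' = q s s' := by
  simp [generator, h]

theorem sum_generator_row (q : S → S → ℝ) (s : S) : ∑ s', generator q s s' = 0 := by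
  rw [← Finset.add_sum_erase _ _ (Finset.mem_univ s),
    Finset.sum_congr rfl fun u hu => generator_off_diag q (Finset.ne_of_mem_erase hu).symm]
  simp [generator]

theorem generator_detailed_balance {q : S → S → ℝ} {w : S → ℝ}
    (hb : ∀ s s', s ≠ s' → w s * q s s' = w s' * q s' s) (s s' : S) :
    w s * generator q s s' = w s' * generator q s' s := by
  rcases eq_or_ne s s' with rfl | h
  · rfl
  · rw [generator_off_diag q h, generator_off_diag q h.symm, hb s s' h]

-- Detailed balance makes `A` self-adjoint for the inner product weighted by `w`, so stationarity of
-- the measure `f * w` becomes harmonicity of the density `f`.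
omit [DecidableEq S] in
theorem vecMul_eq_of_detailed_balance {A : Matrix S S ℝ} {w : S → ℝ}
    (hb : ∀ s s', w s * A s s' = w s' * A s' s) (f : S → ℝ) (s' : S) :
    Matrix.vecMul (fun s => f s * w s) A s' = w s' * ∑ s, A s' s * f s := by
  simp only [Matrix.vecMul, dotProduct, Finset.mul_sum]
  refine Finset.sum_congr rfl fun s _ => ?_
  linear_combination f s * hb s s'

/-- Detailed balance says that conjugation by `diagonal w` turns `A` into its transpose; the
exponential commutes with both operations. -/
theorem exp_detailed_balance {A : Matrix S S ℝ} {w : S → ℝ} (hw : ∀ s, 0 < w s)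
    (hb : ∀ s s', w s * A s s' = w s' * A s' s) (s s' : S) :
    w s * NormedSpace.exp A s s' = w s' * NormedSpace.exp A s' s := by
  have hD : IsUnit (Matrix.diagonal w) := by
    rw [Matrix.isUnit_diagonal]
    exact Pi.isUnit_iff.2 fun s => (hw s).ne'.isUnit
  have hdet : IsUnit (Matrix.diagonal w).det := (Matrix.isUnit_iff_isUnit_det _).1 hD
  have hA : Matrix.diagonal w * A * (Matrix.diagonal w)⁻¹ = A.transpose := by
    have : Matrix.diagonal w * A = A.transpose * Matrix.diagonal w := by
      ext s s'
      rw [Matrix.diagonal_mul, Matrix.mul_diagonal, Matrix.transpose_apply, hb, mul_comm]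
    rw [this, Matrix.mul_assoc, Matrix.mul_nonsing_inv _ hdet, Matrix.mul_one]
  have he : Matrix.diagonal w * NormedSpace.exp A =
      (NormedSpace.exp A).transpose * Matrix.diagonal w := by
    rw [← Matrix.exp_transpose, ← hA, Matrix.exp_conj _ _ hD, Matrix.mul_assoc,
      Matrix.nonsing_inv_mul _ hdet, Matrix.mul_one]
  have := congrFun (congrFun he s) s'
  rw [Matrix.diagonal_mul, Matrix.mul_diagonal, Matrix.transpose_apply] at this
  rw [this, mul_comm]

theorem vecMul_exp_of_vecMul_eq_zero {A : Matrix S S ℝ} {p : S → ℝ}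
    (h : Matrix.vecMul p A = 0) : Matrix.vecMul p (NormedSpace.exp A) = p := by
  -- The norm serves only to make the exponential series converge; all its terms but the zeroth kill
  -- `p`.
  let _ : NormedRing (Matrix S S ℝ) := Matrix.linftyOpNormedRing
  let _ : NormedAlgebra ℝ (Matrix S S ℝ) := Matrix.linftyOpNormedAlgebra
  have hs : HasSum (fun n : ℕ => ((n.factorial : ℝ)⁻¹) • A ^ n) (NormedSpace.exp A) :=
    NormedSpace.exp_series_hasSum_exp' A
  have hm := hs.map (Matrix.vecMulBilin ℝ ℝ p).toAddMonoidHom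
    (by exact Continuous.matrix_vecMul continuous_const continuous_id)
  have h0 : HasSum (fun n : ℕ => Matrix.vecMul p (((n.factorial : ℝ)⁻¹) • A ^ n)) p := by
    have := hasSum_single (f := fun n : ℕ => Matrix.vecMul p (((n.factorial : ℝ)⁻¹) • A ^ n)) 0
      (by
        intro n hn
        obtain ⟨k, rfl⟩ := Nat.exists_eq_succ_of_ne_zero hn
        rw [Matrix.vecMul_smul, pow_succ', ← Matrix.vecMul_vecMul, h, Matrix.zero_vecMul,
          smul_zero])
    simpa using this
  exact hm.unique h0

/-- On a finite connected weighted graph, harmonic functions are constant. -/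
theorem harmonic_const {q : S → S → ℝ} (hq : ∀ s s', 0 ≤ q s s')
    (hirr : ∀ s s', Relation.ReflTransGen (fun u v => u ≠ v ∧ 0 < q u v) s s')
    {f : S → ℝ} (hf : ∀ s, ∑ s', generator q s s' * f s' = 0) (s s' : S) : f s = f s' := by
  obtain ⟨m, -, hm⟩ := Finset.exists_max_image Finset.univ f ⟨s, Finset.mem_univ s⟩
  -- Maximum principle: at a maximizer, the sum of the nonnegative terms `generator q u x * (f m - f
  -- x)` vanishes, so the maximum spreads along positive rates.
  have key : ∀ u, f u = f m → ∀ v, u ≠ v → 0 < q u v → f v = f m := by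
    intro u hu v huv hpos
    have h1 : ∑ x, generator q u x * (f m - f x) = 0 := by
      simp only [mul_sub, Finset.sum_sub_distrib, ← Finset.sum_mul, sum_generator_row, hf]
      ring
    have h2 : ∀ x ∈ Finset.univ, 0 ≤ generator q u x * (f m - f x) := by
      intro x _
      rcases eq_or_ne u x with rfl | hx
      · simp [hu]
      · rw [generator_off_diag q hx]
        exact mul_nonneg (hq _ _) (sub_nonneg.2 (hm x (Finset.mem_univ x)))
    have h3 := (Finset.sum_eq_zero_iff_of_nonneg h2).1 h1 v (Finset.mem_univ v)
    rw [generator_off_diag q huv] at h3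
    rcases mul_eq_zero.1 h3 with h | h
    · exact absurd h hpos.ne'
    · linarith
  have all : ∀ u, f u = f m := by
    intro u
    induction hirr m u with
    | refl => rfl
    | tail _ h ih => exact key _ ih _ h.1 h.2
  rw [all s, all s']

theorem jointProb_reversed {Q : Matrix S S ℝ} {p : S → ℝ} (hp : ∀ s, 0 < p s)
    (hst : Matrix.vecMul p Q = 0) (hb : ∀ s s', p s * Q s s' = p s' * Q s' s)
    {n : ℕ} (t : Fin (n + 1) → ℝ) (t' : ℝ) (s : Fin (n + 1) → S) :
    jointProb Q p t s = jointProb Q p (fun i => t' - t i.rev) (fun i => s i.rev) := by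
  have hinv : ∀ u : ℝ, Matrix.vecMul p (transProb Q u) = p := fun u =>
    vecMul_exp_of_vecMul_eq_zero (by rw [Matrix.vecMul_smul, hst, smul_zero])
  have hbal : ∀ (u : ℝ) (x y : S), p x * transProb Q u x y = p y * transProb Q u y x := by
    intro u
    refine exp_detailed_balance hp fun x y => ?_
    simp only [Matrix.smul_apply, smul_eq_mul]
    linear_combination u * hb x y
  unfold jointProb
  rw [hinv, hinv]
  beta_reduce
  rw [Fin.rev_zero]
  have hrev : ∏ i : Fin n, transProb Q (t' - t i.succ.rev - (t' - t i.castSucc.rev))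
        (s i.castSucc.rev) (s i.succ.rev) =
      ∏ i : Fin n, transProb Q (t i.succ - t i.castSucc) (s i.succ) (s i.castSucc) := by
    rw [← Equiv.prod_comp Fin.revPerm]
    refine Finset.prod_congr rfl fun i _ => ?_
    rw [Fin.revPerm_apply, Fin.rev_succ, Fin.rev_castSucc, Fin.rev_rev]
    congr 1
    ring_nf
  rw [hrev]
  have h1 : ∏ i : Fin n, (p (s i.castSucc) *
        transProb Q (t i.succ - t i.castSucc) (s i.castSucc) (s i.succ)) =
      ∏ i : Fin n, (p (s i.succ) *
        transProb Q (t i.succ - t i.castSucc) (s i.succ) (s i.castSucc)) :=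
    Finset.prod_congr rfl fun i _ => hbal _ _ _
  rw [Finset.prod_mul_distrib, Finset.prod_mul_distrib] at h1
  have h2 : p (s 0) * ∏ i : Fin n, p (s i.succ) =
      (∏ i : Fin n, p (s i.castSucc)) * p (s (Fin.last n)) := by
    rw [← Fin.prod_univ_succ (fun i => p (s i)), ← Fin.prod_univ_castSucc (fun i => p (s i))]
  -- After multiplication by this product, `h1` reverses every step of the path and `h2` telescopes
  -- the weights, leaving only those of the endpoints.
  have h3 : ∏ i : Fin n, p (s i.succ) ≠ 0 := Finset.prod_ne_zero_iff.2 fun i _ => (hp _).ne'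
  refine mul_left_cancel₀ h3 ?_
  linear_combination (∏ i : Fin n, transProb Q (t i.succ - t i.castSucc)
    (s i.castSucc) (s i.succ)) * h2 + p (s (Fin.last n)) * h1

/-- A finite irreducible chain that satisfies detailed balance with respect to some positive weights
is time reversible. -/
theorem isTimeReversible_of_detailed_balance [Nonempty S] {q : S → S → ℝ} {w : S → ℝ}
    (hq : ∀ s s', 0 ≤ q s s')
    (hirr : ∀ s s', Relation.ReflTransGen (fun u v => u ≠ v ∧ 0 < q u v) s s')
    (hw : ∀ s, 0 < w s) (hb : ∀ s s', s ≠ s' → w s * q s s' = w s' * q s' s) :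
    IsTimeReversible (generator q) := by
  have hbQ := generator_detailed_balance hb
  have hsum : 0 < ∑ s, w s := Finset.sum_pos (fun s _ => hw s) Finset.univ_nonempty
  have huniq : ∀ p, IsSteadyState (generator q) p → p = fun s => w s / ∑ u, w u := by
    rintro p ⟨-, hp1, hpQ⟩
    have hpw : p = fun s => p s / w s * w s := by
      ext s
      rw [div_mul_cancel₀ _ (hw s).ne']
    -- Uniqueness: the density of `p` with respect to `w` is harmonic, hence constant, and
    -- normalization fixes the constant.
    have hharm : ∀ s, ∑ s', generator q s s' * (p s' / w s') = 0 := by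
      intro s
      have h := vecMul_eq_of_detailed_balance hbQ (fun s => p s / w s) s
      rw [← hpw, hpQ, Pi.zero_apply] at h
      exact (mul_eq_zero.1 h.symm).resolve_left (hw s).ne'
    have hconst := harmonic_const hq hirr hharm
    ext s
    have h : (p s / w s) * ∑ u, w u = 1 := by
      rw [← hp1, Finset.mul_sum]
      refine Finset.sum_congr rfl fun u _ => ?_
      rw [hconst s u, div_mul_cancel₀ _ (hw u).ne']
    have hs := (hw s).ne'
    field_simp at h ⊢
    linarith
  refine ⟨⟨fun s => w s / ∑ u, w u, ⟨fun s => div_pos (hw s) hsum, ?_, ?_⟩, huniq⟩, ?_⟩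
  · rw [← Finset.sum_div, div_self hsum.ne']
  · ext s'
    have h := vecMul_eq_of_detailed_balance hbQ (fun _ => (∑ u, w u)⁻¹) s'
    rw [← Finset.sum_mul, sum_generator_row, zero_mul, mul_zero] at h
    simpa [div_eq_inv_mul] using h
  · intro p hp n t t' _ _ _ s
    refine jointProb_reversed hp.1 hp.2.2 (fun x y => ?_) t t' s
    rw [huniq p hp]
    linear_combination (∑ u, w u)⁻¹ * hbQ x y

end Reversibility

/-! ### Invariants of terms and renaming of keys -/

namespace Proc

variable {Act Key K : Type*}

/-- Apply a function to all the keys of a process. -/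
def mapKey (f : Key → K) : Proc Act Key → Proc Act K
  | nil => nil
  | pre a r P => pre a r (mapKey f P)
  | past a r k R => past a r (f k) (mapKey f R)
  | choice R S => choice (mapKey f R) (mapKey f S)
  | par R L S => par (mapKey f R) L (mapKey f S)

/-- The process with its keys erased. -/
def shape : Proc Act Key → Proc Act Unit := mapKey fun _ => ()

/-- The process with all its executed prefixes turned back into future ones. -/
def base : Proc Act Key → Proc Act Empty
  | nil => nil
  | pre a r P => pre a r (base P)
  | past a r _ R => pre a r (base R)
  | choice R S => choice (base R) (base S)
  | par R L S => par (base R) L (base S)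

/-- The number of prefixes. -/
def size : Proc Act Key → ℕ
  | nil => 0
  | pre _ _ P => size P + 1
  | past _ _ _ R => size R + 1
  | choice R S => size R + size S
  | par R _ S => size R + size S

/-- The number of executed prefixes. -/
def numPast : Proc Act Key → ℕ
  | nil => 0
  | pre _ _ P => numPast P
  | past _ _ _ R => numPast R + 1
  | choice R S => numPast R + numPast S
  | par R _ S => numPast R + numPast S

/-- The product, over the executed prefixes, of the ratios of the forward to the backward rate. -/
noncomputable def weight (bar : Act → Rate → Rate) : Proc Act Key → ℝ
  | nil => 1
  | pre _ _ P => weight bar P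
  | past a r _ R => (r : ℝ) / (bar a r : ℝ) * weight bar R
  | choice R S => weight bar R * weight bar S
  | par R _ S => weight bar R * weight bar S

theorem weight_pos (bar : Act → Rate → Rate) (R : Proc Act Key) : 0 < weight bar R := by
  induction R with
  | nil => exact one_pos
  | pre a r P ih => exact ih
  | past a r i R ih => exact mul_pos (div_pos r.2 (bar a r).2) ih
  | choice R S ihR ihS => exact mul_pos ihR ihS
  | par R L S ihR ihS => exact mul_pos ihR ihS

theorem shape_mapKey (f : Key → K) (R : Proc Act Key) : (R.mapKey f).shape = R.shape := by
  induction R <;> simp_all [shape, mapKey]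

theorem weight_shape (bar : Act → Rate → Rate) (R : Proc Act Key) :
    R.shape.weight bar = R.weight bar := by
  induction R <;> simp_all [shape, mapKey, weight]

theorem numPast_shape (R : Proc Act Key) : R.shape.numPast = R.numPast := by
  induction R <;> simp_all [shape, mapKey, numPast]

theorem base_shape (R : Proc Act Key) : R.shape.base = R.base := by
  induction R <;> simp_all [shape, mapKey, base]

theorem size_base (R : Proc Act Key) : R.base.size = R.size := by
  induction R <;> simp_all [base, size]

theorem Std.mapKey {R : Proc Act Key} (h : R.Std) (f : Key → K) : (R.mapKey f).Std := by
  induction R <;> simp_all [Proc.mapKey, Std]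

theorem keys_mapKey (f : Key → K) (R : Proc Act Key) : (R.mapKey f).keys = f '' R.keys := by
  induction R <;> simp_all [mapKey, keys, Set.image_union, Set.image_insert_eq]

/-- As `j` does not occur, sending `i` to `j` agrees with the transposition on the keys present.
Unlike the replacement, the transposition is injective on all keys, so it preserves reachability. -/
theorem renameKey_eq_mapKey [DecidableEq Key] (i j : Key) {R : Proc Act Key} (h : j ∉ R.keys) :
    R.renameKey i j = R.mapKey (Equiv.swap i j) := by
  induction R with
  | nil => rfl
  | pre a r P ih => simp_all [renameKey, mapKey, keys]
  | past a r k R ih =>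
    simp only [keys, Set.mem_union, Set.mem_singleton_iff, not_or] at h
    simp only [renameKey, mapKey, ih h.2]
    congr 1
    split_ifs with hk
    · rw [hk, Equiv.swap_apply_left]
    · rw [Equiv.swap_apply_of_ne_of_ne hk (Ne.symm h.1)]
  | choice R S ihR ihS => simp_all [renameKey, mapKey, keys]
  | par R L S ihR ihS => simp_all [renameKey, mapKey, keys]

theorem finite_keys_and_ncard_le (R : Proc Act Key) :
    R.keys.Finite ∧ R.keys.ncard ≤ R.size := by
  induction R with
  | nil => simp [keys, size]
  | pre a r P ih => exact ⟨ih.1, ih.2.trans (Nat.le_succ _)⟩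
  | past a r i R ih =>
    refine ⟨(Set.finite_singleton i).union ih.1, (Set.ncard_union_le _ _).trans ?_⟩
    rw [Set.ncard_singleton, size]
    omega
  | choice R S ihR ihS =>
    exact ⟨ihR.1.union ihS.1, (Set.ncard_union_le _ _).trans (add_le_add ihR.2 ihS.2)⟩
  | par R L S ihR ihS =>
    exact ⟨ihR.1.union ihS.1, (Set.ncard_union_le _ _).trans (add_le_add ihR.2 ihS.2)⟩

/-- A process is recovered from its base by deciding, prefix by prefix, whether it is executed and
with which key. -/
theorem finite_setOf_base_eq {K₀ : Set Key} (hK : K₀.Finite) (B : Proc Act Empty) :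
    {R : Proc Act Key | R.base = B ∧ R.keys ⊆ K₀}.Finite := by
  induction B with
  | nil =>
    refine (Set.finite_singleton nil).subset ?_
    rintro (_ | _ | _ | _ | _) ⟨h, -⟩ <;> simp_all [base]
  | pre a r B ih =>
    refine ((ih.image (pre a r)).union (hK.image2 (past a r) ih)).subset ?_
    rintro (_ | ⟨b, m, P⟩ | ⟨b, m, i, R⟩ | _ | _) ⟨h, hk⟩ <;>
      simp only [base, reduceCtorEq, pre.injEq] at h
    · obtain ⟨rfl, rfl, h⟩ := h
      exact Or.inl ⟨P, ⟨h, hk⟩, rfl⟩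
    · obtain ⟨rfl, rfl, h⟩ := h
      simp only [keys, Set.union_subset_iff, Set.singleton_subset_iff] at hk
      exact Or.inr ⟨i, hk.1, R, ⟨h, hk.2⟩, rfl⟩
  | past a r i B => exact i.elim
  | choice B C ihB ihC =>
    refine (ihB.image2 choice ihC).subset ?_
    rintro (_ | _ | _ | ⟨R, S⟩ | _) ⟨h, hk⟩ <;>
      simp only [base, reduceCtorEq, choice.injEq] at h
    simp only [keys, Set.union_subset_iff] at hk
    exact ⟨R, ⟨h.1, hk.1⟩, S, ⟨h.2, hk.2⟩, rfl⟩
  | par B L C ihB ihC =>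
    refine (ihB.image2 (fun R S => par R L S) ihC).subset ?_
    rintro (_ | _ | _ | _ | ⟨R, M, S⟩) ⟨h, hk⟩ <;>
      simp only [base, reduceCtorEq, par.injEq] at h
    simp only [keys, Set.union_subset_iff] at hk
    obtain ⟨hR, rfl, hS⟩ := h
    exact ⟨R, ⟨hR, hk.1⟩, S, ⟨hS, hk.2⟩, rfl⟩

end Proc

/-- `Step bar R a r r' i R'`: there is a forward transition from `R` to `R'` labeled `<a,r>[i]`, which
is undone by a backward transition labeled `<a,r'>[i]`. -/
inductive Step {Act Key : Type*} (bar : Act → Rate → Rate) :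
    Proc Act Key → Act → Rate → Rate → Key → Proc Act Key → Prop
  | act1 {a : Act} {r : Rate} {i : Key} {R : Proc Act Key} :
      R.Std → Step bar (pre a r R) a r (bar a r) i (past a r i R)
  | act2 {a b : Act} {r m m' : Rate} {i j : Key} {R R' : Proc Act Key} :
      Step bar R b m m' j R' → j ≠ i → Step bar (past a r i R) b m m' j (past a r i R')
  | choL {a : Act} {r r' : Rate} {i : Key} {R R' S : Proc Act Key} :
      Step bar R a r r' i R' → S.Std → Step bar (choice R S) a r r' i (choice R' S)
  | choR {a : Act} {r r' : Rate} {i : Key} {R S S' : Proc Act Key} :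
      Step bar S a r r' i S' → R.Std → Step bar (choice R S) a r r' i (choice R S')
  | parL {a : Act} {r r' : Rate} {i : Key} {R R' S : Proc Act Key} {L : Set Act} :
      Step bar R a r r' i R' → a ∉ L → i ∉ S.keys → Step bar (par R L S) a r r' i (par R' L S)
  | parR {a : Act} {r r' : Rate} {i : Key} {R S S' : Proc Act Key} {L : Set Act} :
      Step bar S a r r' i S' → a ∉ L → i ∉ R.keys → Step bar (par R L S) a r r' i (par R L S')
  | coo {a : Act} {r r' m m' : Rate} {i : Key} {R R' S S' : Proc Act Key} {L : Set Act} :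
      Step bar R a r r' i R' → Step bar S a m m' i S' → a ∈ L →
        Step bar (par R L S) a (r * m) (r' * m') i (par R' L S')

/-! ### Forward transitions paired with their undoing -/

section Step

variable {Act Key K : Type*} {bar : Act → Rate → Rate}

theorem Step.fwd {R R' : Proc Act Key} {a : Act} {r r' : Rate} {i : Key}
    (h : Step bar R a r r' i R') : Fwd R a r i R' := by
  induction h with
  | act1 h => exact .act1 h
  | act2 _ h ih => exact .act2 ih h
  | choL _ h ih => exact .choL ih h
  | choR _ h ih => exact .choR ih h
  | parL _ h h' ih => exact .parL ih h h'
  | parR _ h h' ih => exact .parR ih h h'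
  | coo _ _ h ih ih' => exact .coo ih ih' h

theorem Step.bwd {R R' : Proc Act Key} {a : Act} {r r' : Rate} {i : Key}
    (h : Step bar R a r r' i R') : Bwd bar R' a r' i R := by
  induction h with
  | act1 h => exact .act1 h
  | act2 _ h ih => exact .act2 ih h
  | choL _ h ih => exact .choL ih h
  | choR _ h ih => exact .choR ih h
  | parL _ h h' ih => exact .parL ih h h'
  | parR _ h h' ih => exact .parR ih h h'
  | coo _ _ h ih ih' => exact .coo ih ih' h

/-- The two transition systems differ only in their first rule, so a derivation can be mirrored rule
by rule. -/
theorem Fwd.exists_step (bar : Act → Rate → Rate) {R R' : Proc Act Key} {a : Act} {r : Rate}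
    {i : Key} (h : Fwd R a r i R') : ∃ r', Step bar R a r r' i R' := by
  induction h with
  | act1 h => exact ⟨_, .act1 h⟩
  | act2 _ h ih => exact ih.imp fun _ ih => .act2 ih h
  | choL _ h ih => exact ih.imp fun _ ih => .choL ih h
  | choR _ h ih => exact ih.imp fun _ ih => .choR ih h
  | parL _ h h' ih => exact ih.imp fun _ ih => .parL ih h h'
  | parR _ h h' ih => exact ih.imp fun _ ih => .parR ih h h'
  | coo _ _ h ih ih' =>
    obtain ⟨_, ih⟩ := ih
    obtain ⟨_, ih'⟩ := ih'
    exact ⟨_, .coo ih ih' h⟩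

theorem Bwd.exists_step {R R' : Proc Act Key} {a : Act} {r' : Rate}
    {i : Key} (h : Bwd bar R' a r' i R) : ∃ r, Step bar R a r r' i R' := by
  induction h with
  | act1 h => exact ⟨_, .act1 h⟩
  | act2 _ h ih => exact ih.imp fun _ ih => .act2 ih h
  | choL _ h ih => exact ih.imp fun _ ih => .choL ih h
  | choR _ h ih => exact ih.imp fun _ ih => .choR ih h
  | parL _ h h' ih => exact ih.imp fun _ ih => .parL ih h h'
  | parR _ h h' ih => exact ih.imp fun _ ih => .parR ih h h'
  | coo _ _ h ih ih' =>
    obtain ⟨_, ih⟩ := ih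
    obtain ⟨_, ih'⟩ := ih'
    exact ⟨_, .coo ih ih' h⟩

/-- The increase may exceed one, as a synchronization executes several prefixes. Strictness rules
out loops and steps both ways between two classes. -/
theorem Step.numPast_lt {R R' : Proc Act Key} {a : Act} {r r' : Rate} {i : Key}
    (h : Step bar R a r r' i R') : R.numPast < R'.numPast := by
  induction h <;> simp only [numPast] <;> omega

theorem Step.shape_ne {R R' : Proc Act Key} {a : Act} {r r' : Rate} {i : Key}
    (h : Step bar R a r r' i R') : R.shape ≠ R'.shape := fun e => by
  have := h.numPast_lt
  rw [← numPast_shape R, e, numPast_shape] at this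
  exact lt_irrefl _ this

theorem Step.base_eq {R R' : Proc Act Key} {a : Act} {r r' : Rate} {i : Key}
    (h : Step bar R a r r' i R') : R.base = R'.base := by
  induction h <;> simp_all [base]

theorem Step.weight_balance {R R' : Proc Act Key} {a : Act} {r r' : Rate} {i : Key}
    (h : Step bar R a r r' i R') : R.weight bar * r = R'.weight bar * r' := by
  induction h with
  | @act1 a r i R h =>
    have := (bar a r).2.ne'
    simp only [weight]
    field_simp
  | act2 _ h ih => simp only [weight, mul_assoc, ih]
  | @choL a r r' i R R' S _ h ih => simp only [weight]; linear_combination S.weight bar * ih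
  | @choR a r r' i R S S' _ h ih => simp only [weight]; linear_combination R.weight bar * ih
  | @parL a r r' i R R' S L _ h h' ih => simp only [weight]; linear_combination S.weight bar * ih
  | @parR a r r' i R S S' L _ h h' ih => simp only [weight]; linear_combination R.weight bar * ih
  | @coo a r r' m m' i R R' S S' L _ _ h ih ih' =>
    simp only [weight, Positive.val_mul]
    -- Balance the left component while the right is still `S`, then the right one with the left
    -- already at `R'`.
    linear_combination (S.weight bar * m) * ih + (R'.weight bar * r') * ih'

/-- The label of a transition is determined by its source and target up to keys. -/
theorem Step.label_unique {R R' : Proc Act Key} {a : Act} {r r' : Rate} {i : Key}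
    (h : Step bar R a r r' i R') {T T' : Proc Act Key} {b : Act} {m m' : Rate} {j : Key}
    (h' : Step bar T b m m' j T') (hs : R.shape = T.shape) (hs' : R'.shape = T'.shape) :
    a = b ∧ r = m ∧ r' = m' := by
  induction h generalizing T T' b m m' j with
  | act1 _ =>
    cases h' <;> simp_all [shape, mapKey]
  | act2 _ _ ih =>
    cases h' with
    | act2 h1 _ =>
      simp only [shape, mapKey, past.injEq] at hs hs'
      exact ih h1 hs.2.2.2 hs'.2.2.2
    | _ => simp_all [shape, mapKey]
  | choL h0 _ ih =>
    cases h' with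
    | choL h1 _ =>
      simp only [shape, mapKey, choice.injEq] at hs hs'
      exact ih h1 hs.1 hs'.1
    | choR h1 _ =>
      simp only [shape, mapKey, choice.injEq] at hs hs'
      -- One derivation moves the left component and the other leaves it fixed, whereas a step
      -- always changes the shape. The other mismatched pairs of rules for choice and parallel
      -- composition fail likewise.
      exact absurd (hs.1.trans hs'.1.symm) h0.shape_ne
    | _ => simp_all [shape, mapKey]
  | choR h0 _ ih =>
    cases h' with
    | choL h1 _ =>
      simp only [shape, mapKey, choice.injEq] at hs hs'
      exact absurd (hs.2.trans hs'.2.symm) h0.shape_ne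
    | choR h1 _ =>
      simp only [shape, mapKey, choice.injEq] at hs hs'
      exact ih h1 hs.2 hs'.2
    | _ => simp_all [shape, mapKey]
  | parL h0 _ _ ih =>
    cases h' with
    | parL h1 _ _ =>
      simp only [shape, mapKey, par.injEq] at hs hs'
      exact ih h1 hs.1 hs'.1
    | parR h1 _ _ =>
      simp only [shape, mapKey, par.injEq] at hs hs'
      exact absurd (hs.1.trans hs'.1.symm) h0.shape_ne
    | coo h1 h2 _ =>
      simp only [shape, mapKey, par.injEq] at hs hs'
      exact absurd (hs.2.2.symm.trans hs'.2.2) h2.shape_ne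
    | _ => simp_all [shape, mapKey]
  | parR h0 _ _ ih =>
    cases h' with
    | parL h1 _ _ =>
      simp only [shape, mapKey, par.injEq] at hs hs'
      exact absurd (hs.2.2.trans hs'.2.2.symm) h0.shape_ne
    | parR h1 _ _ =>
      simp only [shape, mapKey, par.injEq] at hs hs'
      exact ih h1 hs.2.2 hs'.2.2
    | coo h1 h2 _ =>
      simp only [shape, mapKey, par.injEq] at hs hs'
      exact absurd (hs.1.symm.trans hs'.1) h1.shape_ne
    | _ => simp_all [shape, mapKey]
  | coo h0 h0' _ ih ih' =>
    cases h' with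
    | parL h1 _ _ =>
      simp only [shape, mapKey, par.injEq] at hs hs'
      exact absurd (hs.2.2.trans hs'.2.2.symm) h0'.shape_ne
    | parR h1 _ _ =>
      simp only [shape, mapKey, par.injEq] at hs hs'
      exact absurd (hs.1.trans hs'.1.symm) h0.shape_ne
    | coo h1 h2 _ =>
      simp only [shape, mapKey, par.injEq] at hs hs'
      obtain ⟨h, rfl, rfl⟩ := ih h1 hs.1 hs'.1
      obtain ⟨-, rfl, rfl⟩ := ih' h2 hs.2.2 hs'.2.2
      exact ⟨h, rfl, rfl⟩
    | _ => simp_all [shape, mapKey]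

/-- Injectivity is what preserves the side conditions on distinct and fresh keys. -/
theorem Fwd.mapKey {f : Key → K} (hf : Function.Injective f) {R R' : Proc Act Key} {a : Act}
    {r : Rate} {i : Key} (h : Fwd R a r i R') : Fwd (R.mapKey f) a r (f i) (R'.mapKey f) := by
  have hk : ∀ {i : Key} {S : Proc Act Key}, i ∉ S.keys → f i ∉ (S.mapKey f).keys := by
    intro i S h
    rwa [keys_mapKey, hf.mem_set_image]
  induction h with
  | act1 h => exact .act1 (h.mapKey f)
  | act2 _ h ih => exact .act2 ih (hf.ne h)
  | choL _ h ih => exact .choL ih (h.mapKey f)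
  | choR _ h ih => exact .choR ih (h.mapKey f)
  | parL _ h h' ih => exact .parL ih h (hk h')
  | parR _ h h' ih => exact .parR ih h (hk h')
  | coo _ _ h ih ih' => exact .coo ih ih' h

theorem Reachable.mapKey {f : Key → K} (hf : Function.Injective f) {R : Proc Act Key}
    (h : Reachable R) : Reachable (R.mapKey f) := by
  obtain ⟨P, hP, h⟩ := h
  exact ⟨P.mapKey f, hP.mapKey f,
    h.lift (Proc.mapKey f) fun _ _ ⟨a, r, i, h⟩ => ⟨a, r, f i, h.mapKey hf⟩⟩

end Step

/-! ### Classes up to keys: labels and finiteness -/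

section Classes

variable {Act Key : Type*} {bar : Act → Rate → Rate}

/-- The shape of a class of processes up to keys. -/
def KClass.shape : KClass Act Key → Proc Act Unit :=
  Quotient.lift (fun R => R.1.shape) fun R S h => by
    induction h with
    | rel R S h =>
      classical
      obtain ⟨i, j, hj, e⟩ := h
      rw [e, renameKey_eq_mapKey i j hj, shape_mapKey]
    | refl => rfl
    | symm _ _ _ ih => exact ih.symm
    | trans _ _ _ _ _ ih ih' => exact ih.trans ih'

theorem KClass.shape_cls (R : RProc Act Key) : KClass.shape R.cls = R.1.shape := rfl

/-- Transitions between classes, with their forward and backward rates. -/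
def StepK (bar : Act → Rate → Rate) (s : KClass Act Key) (a : Act) (r r' : Rate)
    (s' : KClass Act Key) : Prop :=
  ∃ S S' : RProc Act Key, S.cls = s ∧ S'.cls = s' ∧ ∃ i : Key, Step bar S.1 a r r' i S'.1

theorem transK_iff {s s' : KClass Act Key} {a : Act} {r : Rate} :
    TransK bar s a r s' ↔ (∃ r', StepK bar s a r r' s') ∨ ∃ m, StepK bar s' a m r s := by
  constructor
  · rintro (⟨S, S', h, h', i, hf⟩ | ⟨S, S', h, h', i, hb⟩)
    · obtain ⟨r', hs⟩ := hf.exists_step bar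
      exact Or.inl ⟨r', S, S', h, h', i, hs⟩
    · obtain ⟨m, hs⟩ := hb.exists_step
      exact Or.inr ⟨m, S', S, h', h, i, hs⟩
  · rintro (⟨r', S, S', h, h', i, hs⟩ | ⟨m, S', S, h', h, i, hs⟩)
    · exact Or.inl ⟨S, S', h, h', i, hs.fwd⟩
    · exact Or.inr ⟨S, S', h, h', i, hs.bwd⟩

theorem StepK.numPast_lt {s s' : KClass Act Key} {a : Act} {r r' : Rate}
    (h : StepK bar s a r r' s') : s.shape.numPast < s'.shape.numPast := by
  obtain ⟨S, S', rfl, rfl, i, h⟩ := h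
  simpa only [KClass.shape_cls, numPast_shape] using h.numPast_lt

theorem StepK.base_eq {s s' : KClass Act Key} {a : Act} {r r' : Rate}
    (h : StepK bar s a r r' s') : s.shape.base = s'.shape.base := by
  obtain ⟨S, S', rfl, rfl, i, h⟩ := h
  simpa only [KClass.shape_cls, base_shape] using h.base_eq

theorem StepK.weight_balance {s s' : KClass Act Key} {a : Act} {r r' : Rate}
    (h : StepK bar s a r r' s') :
    s.shape.weight bar * r = s'.shape.weight bar * r' := by
  obtain ⟨S, S', rfl, rfl, i, h⟩ := h
  simpa only [KClass.shape_cls, weight_shape] using h.weight_balance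

theorem StepK.label_unique {s s' : KClass Act Key} {a b : Act} {r r' m m' : Rate}
    (h : StepK bar s a r r' s') (h' : StepK bar s b m m' s') : a = b ∧ r = m ∧ r' = m' := by
  obtain ⟨S, S', rfl, rfl, i, h⟩ := h
  obtain ⟨T, T', e, e', j, h'⟩ := h'
  refine h.label_unique h' ?_ ?_
  · rw [← KClass.shape_cls, ← KClass.shape_cls, e]
  · rw [← KClass.shape_cls, ← KClass.shape_cls, e']

theorem TransK.symm {s s' : KClass Act Key} {a : Act} {r : Rate} (h : TransK bar s a r s') :
    ∃ r', TransK bar s' a r' s := by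
  rcases transK_iff.1 h with ⟨r', h⟩ | ⟨m, h⟩
  · exact ⟨r', transK_iff.2 (Or.inr ⟨r, h⟩)⟩
  · exact ⟨m, transK_iff.2 (Or.inl ⟨r, h⟩)⟩

theorem TransK.ne {s s' : KClass Act Key} {a : Act} {r : Rate} (h : TransK bar s a r s') :
    s ≠ s' := by
  rintro rfl
  rcases transK_iff.1 h with ⟨r', h⟩ | ⟨m, h⟩ <;> exact lt_irrefl _ h.numPast_lt

theorem TransK.base_eq {s s' : KClass Act Key} {a : Act} {r : Rate} (h : TransK bar s a r s') :
    s.shape.base = s'.shape.base := by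
  rcases transK_iff.1 h with ⟨r', h⟩ | ⟨m, h⟩
  · exact h.base_eq
  · exact h.base_eq.symm

/-- A second forward label is excluded by uniqueness, a backward one by the growth of `numPast`. The
sum defining the rate thus has a single term. -/
theorem StepK.setOf_transK {s s' : KClass Act Key} {a : Act} {r r' : Rate}
    (h : StepK bar s a r r' s') :
    {l : Act × Rate | TransK bar s l.1 l.2 s'} = {(a, r)} := by
  ext ⟨b, m⟩
  simp only [Set.mem_ofPred_eq, Set.mem_singleton_iff, Prod.mk.injEq, transK_iff]
  constructor
  · rintro (⟨m', h'⟩ | ⟨m', h'⟩)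
    · have := h.label_unique h'
      exact ⟨this.1.symm, this.2.1.symm⟩
    · exact absurd (h.numPast_lt.trans h'.numPast_lt) (lt_irrefl _)
  · rintro ⟨rfl, rfl⟩
    exact Or.inl ⟨r', h⟩

theorem StepK.setOf_transK_symm {s s' : KClass Act Key} {a : Act} {r r' : Rate}
    (h : StepK bar s a r r' s') :
    {l : Act × Rate | TransK bar s' l.1 l.2 s} = {(a, r')} := by
  ext ⟨b, m⟩
  simp only [Set.mem_ofPred_eq, Set.mem_singleton_iff, Prod.mk.injEq, transK_iff]
  constructor
  · rintro (⟨m', h'⟩ | ⟨m', h'⟩)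
    · exact absurd (h.numPast_lt.trans h'.numPast_lt) (lt_irrefl _)
    · have := h.label_unique h'
      exact ⟨this.1.symm, this.2.2.symm⟩
  · rintro ⟨rfl, rfl⟩
    exact Or.inr ⟨r, h⟩

/-- Between two classes there is at most one transition. -/
theorem finite_setOf_transK (s s' : KClass Act Key) :
    {l : Act × Rate | TransK bar s l.1 l.2 s'}.Finite := by
  rcases Set.eq_empty_or_nonempty {l : Act × Rate | TransK bar s l.1 l.2 s'} with h | ⟨l, hl⟩
  · rw [h]
    exact Set.finite_empty
  · rcases transK_iff.1 hl with ⟨r', h⟩ | ⟨m, h⟩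
    · rw [h.setOf_transK]
      exact Set.finite_singleton _
    · rw [h.setOf_transK_symm]
      exact Set.finite_singleton _

/-- The keys of a process can be renamed into any sufficiently large finite set. -/
theorem exists_cls_eq_keys_subset (K₀ : Finset Key) (R : RProc Act Key)
    (hR : R.1.size ≤ K₀.card) : ∃ S : RProc Act Key, S.cls = R.cls ∧ S.1.keys ⊆ K₀ := by
  classical
  -- The size depends only on the shape, so the bound on `R` passes to every member of its class.
  have hsz : ∀ T : Proc Act Key, T.shape = R.1.shape → T.size ≤ K₀.card := fun T hT => by
    rwa [← size_base, ← base_shape, hT, base_shape, size_base]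
  suffices H : ∀ (n : ℕ) (T : RProc Act Key), T.cls = R.cls →
      (T.1.keys \ K₀).ncard ≤ n → ∃ S : RProc Act Key, S.cls = R.cls ∧ S.1.keys ⊆ K₀ from
    H _ R rfl le_rfl
  intro n
  induction n with
  | zero =>
    intro T hT hn
    have hfin := (finite_keys_and_ncard_le T.1).1.subset (Set.sdiff_subset (t := (K₀ : Set Key)))
    exact ⟨T, hT, Set.sdiff_eq_empty.1 ((Set.ncard_eq_zero hfin).1 (Nat.le_zero.1 hn))⟩
  | succ n ih =>
    intro T hT hn
    obtain ⟨hfin, hcard⟩ := finite_keys_and_ncard_le T.1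
    by_cases hsub : T.1.keys ⊆ K₀
    · exact ⟨T, hT, hsub⟩
    obtain ⟨i, hi, hiK⟩ := Set.not_subset.1 hsub
    have hTs : T.1.shape = R.1.shape := by
      rw [← KClass.shape_cls, ← KClass.shape_cls, hT]
    -- Pigeonhole: if all of `K₀` occurred in `T`, the bound on the number of keys would force
    -- equality, yet `i` lies outside `K₀`.
    obtain ⟨j, hjK, hj⟩ : ∃ j ∈ K₀, j ∉ T.1.keys := by
      by_contra! hall
      have hle : T.1.keys.ncard ≤ (K₀ : Set Key).ncard := by
        rw [Set.ncard_coe_finset]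
        exact hcard.trans (hsz _ hTs)
      have := Set.eq_of_subset_of_ncard_le (s := (K₀ : Set Key)) hall hle hfin
      exact hiK (this ▸ hi)
    -- The swap moves `i` into `K₀` and fixes the other keys of `T`, so one key fewer lies outside.
    let T' : RProc Act Key := ⟨T.1.mapKey (Equiv.swap i j), T.2.mapKey (Equiv.injective _)⟩
    have hcls : T'.cls = T.cls :=
      (Quotient.sound (s := keyEquiv Act Key)
        (.rel _ _ ⟨i, j, hj, (renameKey_eq_mapKey i j hj).symm⟩)).symm
    refine ih T' (hcls.trans hT) ?_
    have hss : T'.1.keys \ K₀ ⊆ (T.1.keys \ K₀) \ {i} := by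
      rintro k ⟨hk, hkK⟩
      rw [keys_mapKey] at hk
      obtain ⟨l, hl, rfl⟩ := hk
      have hlj : l ≠ j := fun e => hj (e ▸ hl)
      by_cases hli : l = i
      · rw [hli, Equiv.swap_apply_left] at hkK
        exact absurd hjK hkK
      · rw [Equiv.swap_apply_of_ne_of_ne hli hlj] at hkK ⊢
        exact ⟨⟨hl, hkK⟩, hli⟩
    have hfin' := hfin.subset (Set.sdiff_subset (t := (K₀ : Set Key)))
    have h1 := Set.ncard_le_ncard hss (hfin'.subset Set.sdiff_subset)
    have h2 := Set.ncard_sdiff_singleton_lt_of_mem (show i ∈ T.1.keys \ K₀ from ⟨hi, hiK⟩) hfin'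
    omega

theorem finite_setOf_shape_base_eq [Infinite Key] (B : Proc Act Empty) :
    {s : KClass Act Key | s.shape.base = B}.Finite := by
  obtain ⟨K₀, hK₀⟩ := Infinite.exists_subset_card_eq Key B.size
  have hfin : {R : RProc Act Key | R.1.base = B ∧ R.1.keys ⊆ K₀}.Finite :=
    (finite_setOf_base_eq K₀.finite_toSet B).preimage Subtype.val_injective.injOn
  refine (hfin.image RProc.cls).subset ?_
  intro s hs
  obtain ⟨R, rfl⟩ := Quotient.exists_rep s
  have hB : ∀ T : RProc Act Key, T.cls = R.cls → T.1.base = B := fun T hT => by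
    rw [← base_shape, ← KClass.shape_cls, hT]
    exact hs
  obtain ⟨T, hT, hTK⟩ := exists_cls_eq_keys_subset K₀ R
    (by rw [hK₀, ← size_base, hB R rfl])
  exact ⟨T, ⟨hB T hT, hTK⟩, hT⟩

/-- The base is constant along transitions in either direction, so all states lie over the base of
`R`. -/
theorem finite_chainState [Infinite Key] (bar : Act → Rate → Rate) (R : RProc Act Key) :
    Finite (ChainState bar R) := by
  refine ((finite_setOf_shape_base_eq (KClass.shape R.cls).base).subset ?_).to_subtype
  intro s hs
  induction hs with
  | refl => rfl
  | tail _ h ih =>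
    obtain ⟨a, r, h⟩ := h
    exact h.base_eq.symm.trans ih

/-! ### The underlying chain: rates, detailed balance, irreducibility -/

theorem chainRate_nonneg (R : RProc Act Key) (s s' : ChainState bar R) :
    0 ≤ chainRate bar R s s' :=
  finsum_nonneg fun l => finsum_nonneg fun _ => l.2.2.le

theorem chainRate_of_stepK {R : RProc Act Key} {s s' : ChainState bar R} {a : Act} {r r' : Rate}
    (h : StepK bar s.1 a r r' s'.1) : chainRate bar R s s' = r ∧ chainRate bar R s' s = r' := by
  unfold chainRate
  rw [h.setOf_transK, h.setOf_transK_symm, finsum_mem_singleton, finsum_mem_singleton]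
  exact ⟨rfl, rfl⟩

theorem chainRate_pos {R : RProc Act Key} {s s' : ChainState bar R} {a : Act} {r : Rate}
    (h : TransK bar s.1 a r s'.1) : 0 < chainRate bar R s s' := by
  rcases transK_iff.1 h with ⟨r', h⟩ | ⟨m, h⟩
  · rw [(chainRate_of_stepK h).1]
    exact r.2
  · rw [(chainRate_of_stepK h).2]
    exact r.2

theorem chainRate_detailed_balance (R : RProc Act Key) (s s' : ChainState bar R) :
    s.1.shape.weight bar * chainRate bar R s s' =
      s'.1.shape.weight bar * chainRate bar R s' s := by
  by_cases hex : ∃ (a : Act) (r : Rate), TransK bar s.1 a r s'.1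
  · obtain ⟨a, r, h⟩ := hex
    rcases transK_iff.1 h with ⟨r', h⟩ | ⟨m, h⟩ <;>
      rw [(chainRate_of_stepK h).1, (chainRate_of_stepK h).2, h.weight_balance]
  -- Transitions come in opposite pairs, so without one from `s` to `s'` both rates are empty sums.
  · push Not at hex
    have h1 : {l : Act × Rate | TransK bar s.1 l.1 l.2 s'.1} = ∅ :=
      Set.eq_empty_of_forall_notMem fun l hl => hex _ _ hl
    have h2 : {l : Act × Rate | TransK bar s'.1 l.1 l.2 s.1} = ∅ :=
      Set.eq_empty_of_forall_notMem fun l hl => hl.symm.elim fun r h => hex _ r h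
    unfold chainRate
    rw [h1, h2, finsum_mem_empty, mul_zero, mul_zero]

/-- Each transition has an opposite one, so a path from the initial state can be retraced; any two
states are joined through it. -/
theorem chainState_irreducible (R : RProc Act Key) (s s' : ChainState bar R) :
    Relation.ReflTransGen (fun u v => u ≠ v ∧ 0 < chainRate bar R u v) s s' := by
  have hsymm : ∀ u v : ChainState bar R, (∃ a r, TransK bar u.1 a r v.1) →
      (v ≠ u ∧ 0 < chainRate bar R v u) ∧ (u ≠ v ∧ 0 < chainRate bar R u v) := by
    rintro u v ⟨a, r, h⟩
    obtain ⟨r', h'⟩ := h.symm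
    exact ⟨⟨fun e => h'.ne (congrArg Subtype.val e), chainRate_pos h'⟩,
      ⟨fun e => h.ne (congrArg Subtype.val e), chainRate_pos h⟩⟩
  let s₀ : ChainState bar R := ⟨R.cls, .refl⟩
  have key : ∀ (s : KClass Act Key) (hs : Relation.ReflTransGen
        (fun u v => ∃ (a : Act) (r : Rate), TransK bar u a r v) R.cls s),
      Relation.ReflTransGen (fun u v => u ≠ v ∧ 0 < chainRate bar R u v) s₀ ⟨s, hs⟩ ∧
      Relation.ReflTransGen (fun u v => u ≠ v ∧ 0 < chainRate bar R u v) ⟨s, hs⟩ s₀ := by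
    intro s hs
    induction hs with
    | refl => exact ⟨.refl, .refl⟩
    | @tail u v hu huv ih =>
      have := hsymm ⟨u, hu⟩ ⟨v, hu.tail huv⟩ huv
      exact ⟨ih.1.tail this.2, ih.2.head this.1⟩
  exact (key s.1 s.2).2.trans (key s'.1 s'.2).1

/-- The chain underlying any reachable process is time reversible: the product of the ratios of
forward to backward rates over the executed prefixes satisfies detailed balance. -/
theorem underlyingTimeReversible [Infinite Key] (bar : Act → Rate → Rate) (R : RProc Act Key) :
    UnderlyingTimeReversible bar R := by
  classical
  have := finite_chainState bar R
  have : Nonempty (ChainState bar R) := ⟨⟨R.cls, .refl⟩⟩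
  refine ⟨fun s s' => finite_setOf_transK s.1 s'.1, Fintype.ofFinite _, ?_⟩
  let _ := Fintype.ofFinite (ChainState bar R)
  exact isTimeReversible_of_detailed_balance (w := fun s => s.1.shape.weight bar)
    (chainRate_nonneg R) (chainState_irreducible R) (fun s => weight_pos bar _)
    fun s s' _ => chainRate_detailed_balance R s s'

end Classes

end RMPC

theorem mainTheorem7 {Act Key : Type*} [Countable Act] [Countable Key] [Infinite Key]
    (bar : Act → RMPC.Rate → RMPC.Rate)
    (R₁ R₂ : RMPC.Proc Act Key) (_h₁ : RMPC.Reachable R₁) (_h₂ : RMPC.Reachable R₂)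
    (L : Set Act) (h : RMPC.Reachable (RMPC.Proc.par R₁ L R₂))
    (hyp : (∀ (a : Act) (r : RMPC.Rate), bar a r = r) ∨ (R₁.NoPar ∧ R₂.NoPar)) :
    RMPC.UnderlyingTimeReversible bar ⟨RMPC.Proc.par R₁ L R₂, h⟩ :=
  RMPC.underlyingTimeReversible bar _
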